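/- Let $\mathcal S_\infty$ be the group of permutations of $\mathbb N=\{1,2,\dots\}$ that move only finitely many indices, acting on $\mathbb R^\infty=\mathbb R^{\mathbb N}$ by $g(x)=(x_{\sigma(1)},x_{\sigma(2)},\dots)$. A Borel measure on $\mathbb R^\infty$ is exchangeable if it is invariant under all $g\in\mathcal S_\infty$; a Borel measure on $\mathbb R^\infty\times\mathbb R^\infty$ is exchangeable if it is invariant under all maps $(x,y)\mapsto(g(x),g(y))$, $g\in\mathcal S_\infty$; a map $T:\mathbb R^\infty\to\mathbb R^\infty$ is exchangeable if $T\circ g=g\circ T$ for all $g\in\mathcal S_\infty$. Let $\mu,\nu$ be exchangeable Borel probability measures on $\mathbb R^\infty$ with $$\int x_1^2\,d\mu+\int y_1^2\,d\nu<\infty .$$ For each $n$ let $\mu_n,\nu_n$ be the projections of $\mu,\nu$ onto the first $n$ coordinates, regarded as measures on Euclidean $\mathbb R^n$. Assume that for every $n$ there is an everywhere differentiable convex function $\Phi_n:\mathbb R^n\to\mathbb R$ whose gradient pushes $\mu_n$ forward to $\nu_n$ (a Brenier potential), and that there is a constant $K>0$, independent of $n$, such that $$\Phi_n(a)-\Phi_n(b)-\langle\nabla\Phi_n(b),a-b\rangle\le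 K\|a-b\|^2\qquad\text{for all } n \text{ and all } a,b\in\mathbb R^n$$ (up to the value of the constant: the gradients $\nabla\Phi_n$ are Lipschitz, uniformly in $n$). Then the exchangeable Monge problem for $\mu,\nu$ has a solution: there is a Borel exchangeable map $T:\mathbb R^\infty\to\mathbb R^\infty$ such that the image $\pi$ of $\mu$ under $x\mapsto(x,T(x))$ is an exchangeable measure with marginals $\mu,\nu$ which minimizes $\int(x_1-y_1)^2\,d\pi$ among all exchangeable measures on $\mathbb R^\infty\times\mathbb R^\infty$ with marginals $\mu,\nu$. Moreover, $T=(T_1,T_2,\dots)$ can be chosen so that for some subsequence $n_1<n_2<\cdots$ and every $i$, the functions $x\mapsto\partial_{x_i}\Phi_{n_k}(x_1,\dots,x_{n_k})$ (defined as soon as $n_k\ge i$) converge to $T_i$ in $\mu$-measure as $k\to\infty$. -/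

import Mathlib

open MeasureTheory Filter

noncomputable section

namespace ExchangeableOT

/-- The infinite permutation group: permutations of `ℕ` moving only finitely many indices. -/
def IsFinitePerm (σ : Equiv.Perm ℕ) : Prop :=
  {i | σ i ≠ i}.Finite

/-- The linear operator on `ℝ^∞` that permutes the coordinates by `σ`. -/
def permute (σ : Equiv.Perm ℕ) (x : ℕ → ℝ) : ℕ → ℝ :=
  fun i => x (σ i)

/-- Exchangeability of a measure on `ℝ^∞`. -/
def IsExchangeable (μ : Measure (ℕ → ℝ)) : Prop :=
  ∀ σ : Equiv.Perm ℕ, IsFinitePerm σ → μ.map (permute σ) = μ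

/-- Exchangeability of a measure on `ℝ^∞ × ℝ^∞`: invariance under `(x, y) ↦ (g x, g y)`. -/
def IsExchangeablePlan (π : Measure ((ℕ → ℝ) × (ℕ → ℝ))) : Prop :=
  ∀ σ : Equiv.Perm ℕ, IsFinitePerm σ → π.map (Prod.map (permute σ) (permute σ)) = π

/-- Exchangeability of a mapping of `ℝ^∞` into itself (everywhere, not just almost everywhere). -/
def IsExchangeableMap (T : (ℕ → ℝ) → (ℕ → ℝ)) : Prop :=
  ∀ σ : Equiv.Perm ℕ, IsFinitePerm σ → T ∘ permute σ = permute σ ∘ T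

/-- The set of exchangeable measures on `ℝ^∞ × ℝ^∞` with marginals `μ` and `ν`. -/
def exchangeablePlans (μ ν : Measure (ℕ → ℝ)) : Set (Measure ((ℕ → ℝ) × (ℕ → ℝ))) :=
  {π | IsExchangeablePlan π ∧ π.map Prod.fst = μ ∧ π.map Prod.snd = ν}

/-- The cost `∫ (x₁ - y₁)² dπ`, as an element of `[0, ∞]`; the first coordinate has index `0`. -/
def cost (π : Measure ((ℕ → ℝ) × (ℕ → ℝ))) : ENNReal :=
  ∫⁻ p, ENNReal.ofReal ((p.1 0 - p.2 0) ^ 2) ∂π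

/-- `π` solves the exchangeable Kantorovich problem for `μ`, `ν`. -/
def SolvesKantorovich (μ ν : Measure (ℕ → ℝ)) (π : Measure ((ℕ → ℝ) × (ℕ → ℝ))) : Prop :=
  π ∈ exchangeablePlans μ ν ∧ ∀ π' ∈ exchangeablePlans μ ν, cost π ≤ cost π'

/-- `T` solves the exchangeable Monge problem for `μ`, `ν`, i.e. `T` is an exchangeable optimal
transportation of `μ` onto `ν`. -/
def SolvesMonge (μ ν : Measure (ℕ → ℝ)) (T : (ℕ → ℝ) → (ℕ → ℝ)) : Prop :=
  Measurable T ∧ IsExchangeableMap T ∧ SolvesKantorovich μ ν (μ.map fun x => (x, T x))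

/-- The projection of `ℝ^∞` onto the first `n` coordinates, as a map into Euclidean `ℝ^n`. -/
def proj (n : ℕ) (x : ℕ → ℝ) : EuclideanSpace ℝ (Fin n) :=
  WithLp.toLp 2 fun i => x i

/-- `Φ` is an (everywhere differentiable) Brenier potential from `m` to `m'`: a convex function
whose gradient pushes `m` forward to `m'`. -/
def IsBrenierPotential {n : ℕ} (m m' : Measure (EuclideanSpace ℝ (Fin n)))
    (Φ : EuclideanSpace ℝ (Fin n) → ℝ) : Prop :=
  ConvexOn ℝ Set.univ Φ ∧ Differentiable ℝ Φ ∧ m.map (gradient Φ) = m'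

/-- The functions `Φ n` are Brenier potentials of the projections of `μ` and `ν` to `ℝ^n`, and
they are semiconcave with a constant `K` that does not depend on `n`. -/
def AssumptionA (μ ν : Measure (ℕ → ℝ)) (Φ : ∀ n : ℕ, EuclideanSpace ℝ (Fin n) → ℝ) : Prop :=
  (∀ n, IsBrenierPotential (μ.map (proj n)) (ν.map (proj n)) (Φ n)) ∧
    ∃ K : ℝ, 0 < K ∧ ∀ (n : ℕ) (a b : EuclideanSpace ℝ (Fin n)),
      Φ n a - Φ n b - inner ℝ (gradient (Φ n) b) (a - b) ≤ K * ‖a - b‖ ^ 2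

/-- The `i`-th partial derivative of a function `Φ` of the first `n` coordinates, as a function
on `ℝ^∞`; it vanishes for `i` outside of the first `n` indices. -/
def gradCoord {n : ℕ} (Φ : EuclideanSpace ℝ (Fin n) → ℝ) (i : ℕ) (x : ℕ → ℝ) : ℝ :=
  if h : i < n then gradient Φ (proj n x) ⟨i, h⟩ else 0

end ExchangeableOT

end

/-! Everything rests on a quantitative stability of Brenier maps. If `Φ` is convex and semiconcave
with constant `K`, and `ψ` is its conjugate, the Fenchel–Young gap `Φ x + ψ y - ⟨x, y⟩` is at least
`‖y - ∇Φ x‖² / (4K)`. Integrated over a coupling `(X, Y)` with the right marginals, this bounds `E‖Y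
- ∇Φ(X)‖²` by `2K` times the excess of the cost of `(X, Y)` over that of the Brenier map
(`integral_norm_sub_gradient_sq_le`, and `sum_integral_sub_gradCoord_sq_le` in coordinates).

The estimate is used with three competitors. Conjugating `∇Φ_n` by a permutation leaves the cost
unchanged, so the excess is zero and `∇Φ_n` is equivariant almost everywhere. Hence all coordinates
contribute equally, and the cost in dimension `n` is `n c_n`, where `c_n` is the cost of the first
coordinate. Next, the first `n` coordinates of `∇Φ_m`, `m ≥ n`, are a competitor in dimension `n`.
Both sides of the estimate then carry a factor `n`; after cancellation, `‖∂₀Φ_m - ∂₀Φ_n‖² ≤ 2K (c_m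
- c_n)` in `L²(μ)`. So `c_n` increases, is bounded by second moments, and the partial derivatives
are Cauchy in `L²`. Finally, projecting an exchangeable plan `π` gives `c_n ≤ cost π`.

The `L²` limit inherits equivariance almost everywhere, and everywhere after a change on a null set.
It pushes `μ` to `ν` by passing to the limit in finite-dimensional marginals, and Fatou's lemma
bounds its cost by that of every exchangeable plan. -/

namespace ExchangeableOT

/-! ### Stability of Brenier maps with semiconcave potentials -/

section Potential

variable {E : Type*} [NormedAddCommGroup E] [InnerProductSpace ℝ E] [CompleteSpace E]
  {Φ : E → ℝ} {K : ℝ}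

/-- The tangent hyperplanes of a convex function lie below its graph. -/
theorem convexOn_inner_gradient_le (hc : ConvexOn ℝ Set.univ Φ) {x : E}
    (hd : DifferentiableAt ℝ Φ x) (z : E) :
    Φ x + inner ℝ (gradient Φ x) (z - x) ≤ Φ z := by
  have hg : ConvexOn ℝ Set.univ (Φ ∘ AffineMap.lineMap (k := ℝ) x z) := by
    simpa using hc.comp_affineMap (AffineMap.lineMap (k := ℝ) x z)
  have hl : HasDerivAt (AffineMap.lineMap (k := ℝ) x z) (z - x) (0 : ℝ) :=
    AffineMap.hasDerivAt_lineMap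
  have hΦ : HasFDerivAt Φ (fderiv ℝ Φ x) (AffineMap.lineMap (k := ℝ) x z (0 : ℝ)) := by
    simpa using hd.hasFDerivAt
  have h := hg.le_slope_of_hasDerivAt (Set.mem_univ 0) (Set.mem_univ 1) zero_lt_one
    (hΦ.comp_hasDerivAt (0 : ℝ) hl)
  have e : inner ℝ (gradient Φ x) (z - x) = fderiv ℝ Φ x (z - x) := by
    rw [← toDual_gradient, InnerProductSpace.toDual_apply_apply]
  simp only [slope_def_field, Function.comp_apply, AffineMap.lineMap_apply_zero,
    AffineMap.lineMap_apply_one, sub_zero, div_one] at h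
  linarith

variable [MeasurableSpace E] [BorelSpace E]

theorem measurable_gradient (Φ : E → ℝ) : Measurable (gradient Φ) :=
  (InnerProductSpace.toDual ℝ E).symm.continuous.measurable.comp (measurable_fderiv ℝ Φ)

/-- A measurable version of the Legendre transform of a differentiable convex function `Φ`.
Semiconcavity of `Φ` gives a quadratic lower bound in the Fenchel–Young inequality. -/
theorem exists_measurable_conjugate [SecondCountableTopology E]
    (hc : ConvexOn ℝ Set.univ Φ) (hd : Differentiable ℝ Φ) (hK : 0 < K)
    (hs : ∀ a b : E, Φ a - Φ b - inner ℝ (gradient Φ b) (a - b) ≤ K * ‖a - b‖ ^ 2) :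
    ∃ (ψ : E → ℝ) (B : Set E), Measurable ψ ∧ MeasurableSet B ∧ (∀ x, gradient Φ x ∈ B) ∧
      (∀ x, ψ (gradient Φ x) = inner ℝ x (gradient Φ x) - Φ x) ∧
      ∀ y ∈ B, ∀ x, ‖y - gradient Φ x‖ ^ 2 ≤ 4 * K * (Φ x + ψ y - inner ℝ x y) := by
  -- A supremum over a countable dense set is measurable, and equals the full one by continuity. An
  -- unbounded real supremum has the default value `0`, so `ψ` is meaningful only on the set `B`
  -- where the family is bounded above.
  let d : ℕ → E := TopologicalSpace.denseSeq E
  have hdense : DenseRange d := TopologicalSpace.denseRange_denseSeq E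
  let f : ℕ → E → ℝ := fun k y => inner ℝ (d k) y - Φ (d k)
  have hf : ∀ k, Measurable (f k) := fun k => by fun_prop
  have hcont : ∀ y, Continuous fun x => inner ℝ x y - Φ x := fun y => by
    have := hd.continuous
    fun_prop
  have hle : ∀ y, BddAbove (Set.range fun k => f k y) → ∀ x,
      inner ℝ x y - Φ x ≤ ⨆ k, f k y := fun y hy x =>
    hdense.induction_on (p := fun x => inner ℝ x y - Φ x ≤ ⨆ k, f k y) x
      (isClosed_le (hcont y) continuous_const) fun k => le_ciSup hy k
  have hmax : ∀ x k, f k (gradient Φ x) ≤ inner ℝ x (gradient Φ x) - Φ x := fun x k => by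
    have h := convexOn_inner_gradient_le hc (hd x) (d k)
    rw [inner_sub_right, real_inner_comm, real_inner_comm x] at h
    simp only [f]
    linarith
  have hbdd : ∀ x, BddAbove (Set.range fun k => f k (gradient Φ x)) := fun x =>
    ⟨_, by rintro _ ⟨k, rfl⟩; exact hmax x k⟩
  refine ⟨fun y => ⨆ k, f k y, {y | BddAbove (Set.range fun k => f k y)}, Measurable.iSup hf,
    measurableSet_bddAbove_range hf, hbdd,
    fun x => le_antisymm (ciSup_le (hmax x)) (hle _ (hbdd x) x), fun y hy x => ?_⟩
  -- Testing the supremum at `x + s • v` with `v = y - ∇Φ x` gives a gap of at least `(s - K * s ^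
  -- 2) * ‖v‖ ^ 2`, which is largest at `s = 1 / (2K)`.
  have h₁ := hle y hy (x + (2 * K)⁻¹ • (y - gradient Φ x))
  have h₂ := hs (x + (2 * K)⁻¹ • (y - gradient Φ x)) x
  rw [add_sub_cancel_left, norm_smul, inner_smul_right] at h₂
  rw [inner_add_left, inner_smul_left] at h₁
  have h₃ : inner ℝ (y - gradient Φ x) y - inner ℝ (gradient Φ x) (y - gradient Φ x)
      = ‖y - gradient Φ x‖ ^ 2 := by
    rw [real_inner_comm (y - gradient Φ x) (gradient Φ x), ← inner_sub_right,
      real_inner_self_eq_norm_sq]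
  have hn : ‖(2 * K)⁻¹‖ = (2 * K)⁻¹ := by
    rw [Real.norm_of_nonneg (by positivity)]
  rw [hn] at h₂
  simp only [conj_trivial] at h₁
  have h₄ : (2 * K)⁻¹ * ‖y - gradient Φ x‖ ^ 2 - K * ((2 * K)⁻¹ * ‖y - gradient Φ x‖) ^ 2
      ≤ Φ x + (⨆ k, f k y) - inner ℝ x y := by
    rw [← h₃, mul_pow, ← h₃] at *
    linarith
  have h₅ : (2 * K)⁻¹ * ‖y - gradient Φ x‖ ^ 2 - K * ((2 * K)⁻¹ * ‖y - gradient Φ x‖) ^ 2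
      = ‖y - gradient Φ x‖ ^ 2 / (4 * K) := by
    field_simp
    ring
  rw [h₅, div_le_iff₀ (by positivity)] at h₄
  linarith

/-- Stability of the quadratic transport problem: the distance of a coupling `(X, Y)` from the
graph of the gradient of a semiconcave Brenier potential is controlled by its cost excess. -/
theorem integral_norm_sub_gradient_sq_le [SecondCountableTopology E]
    (hc : ConvexOn ℝ Set.univ Φ) (hd : Differentiable ℝ Φ) (hK : 0 < K)
    (hs : ∀ a b : E, Φ a - Φ b - inner ℝ (gradient Φ b) (a - b) ≤ K * ‖a - b‖ ^ 2)
    {Ω : Type*} [MeasurableSpace Ω] {P : Measure Ω} [IsProbabilityMeasure P] {X Y : Ω → E}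
    (hXm : Measurable X) (hYm : Measurable Y) (hX : MemLp X 2 P) (hY : MemLp Y 2 P)
    (h : P.map Y = P.map fun ω => gradient Φ (X ω)) :
    ∫ ω, ‖Y ω - gradient Φ (X ω)‖ ^ 2 ∂P ≤
      2 * K * (∫ ω, ‖X ω - Y ω‖ ^ 2 ∂P - ∫ ω, ‖X ω - gradient Φ (X ω)‖ ^ 2 ∂P) := by
  obtain ⟨ψ, B, hψ, hB, hgB, hψg, hFY⟩ := exists_measurable_conjugate hc hd hK hs
  have hTm : Measurable fun ω => gradient Φ (X ω) := (measurable_gradient Φ).comp hXm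
  have hid : ProbabilityTheory.IdentDistrib Y (fun ω => gradient Φ (X ω)) P P :=
    ⟨hYm.aemeasurable, hTm.aemeasurable, h⟩
  have hT : MemLp (fun ω => gradient Φ (X ω)) 2 P := hid.memLp_iff.1 hY
  -- Minus its tangent at `0`, `Φ` lies between `0` (convexity) and `K * ‖x‖ ^ 2` (semiconcavity).
  have iΦ : Integrable (fun ω => Φ (X ω)) P := by
    have i₀ : Integrable (fun ω => inner ℝ (gradient Φ 0) (X ω)) P :=
      (hX.integrable (by norm_num)).const_inner _
    have i₁ : Integrable (fun ω => Φ (X ω) - Φ 0 - inner ℝ (gradient Φ 0) (X ω)) P := by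
      refine ((hX.integrable_norm_pow two_ne_zero).const_mul K).mono' ?_ ?_
      · have := hd.continuous.measurable.comp hXm
        exact ((this.sub_const _).aestronglyMeasurable).sub i₀.1
      · refine ae_of_all _ fun ω => ?_
        have a := hs (X ω) 0
        have b := convexOn_inner_gradient_le hc (hd 0) (X ω)
        simp only [sub_zero] at a b
        rw [Real.norm_of_nonneg (by linarith)]
        exact a
    refine ((i₁.add i₀).add (integrable_const (Φ 0))).congr (ae_of_all _ fun ω => ?_)
    simp
  have iX2 := hX.integrable_norm_pow two_ne_zero
  have iY2 := hY.integrable_norm_pow two_ne_zero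
  have iT2 := hT.integrable_norm_pow two_ne_zero
  have integrable_inner : ∀ Z : Ω → E, MemLp Z 2 P →
      Integrable (fun ω => inner ℝ (X ω) (Z ω)) P := fun Z hZ =>
    (iX2.add (hZ.integrable_norm_pow two_ne_zero)).mono' (hX.1.inner hZ.1)
      (ae_of_all _ fun ω => (norm_inner_le_norm _ _).trans (by
        simp only [Pi.add_apply]
        nlinarith [sq_nonneg (‖X ω‖ - ‖Z ω‖), sq_nonneg (‖X ω‖ + ‖Z ω‖)]))
  have iXT := integrable_inner _ hT
  have iXY := integrable_inner _ hY
  -- `ψ` is controlled only on the range of the gradient; equality in law carries integrability, the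
  -- integral and membership in `B` over to `Y`.
  have hidψ := hid.comp hψ
  have iψ' : Integrable (fun ω => ψ (gradient Φ (X ω))) P := by
    simp only [hψg]
    exact iXT.sub iΦ
  have iψ : Integrable (fun ω => ψ (Y ω)) P := hidψ.integrable_iff.2 iψ'
  have eψ : ∫ ω, ψ (Y ω) ∂P = ∫ ω, inner ℝ (X ω) (gradient Φ (X ω)) ∂P - ∫ ω, Φ (X ω) ∂P := by
    rw [← integral_sub iXT iΦ]
    simp only [← hψg]
    exact hidψ.integral_eq
  have hYB : ∀ᵐ ω ∂P, Y ω ∈ B :=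
    hid.symm.ae_mem_snd hB (ae_of_all _ fun ω => hgB _)
  have eN : ∫ ω, ‖Y ω‖ ^ 2 ∂P = ∫ ω, ‖gradient Φ (X ω)‖ ^ 2 ∂P :=
    (hid.comp (u := fun y => ‖y‖ ^ 2) (by fun_prop)).integral_eq
  have expand : ∀ Z : Ω → E, Integrable (fun ω => ‖Z ω‖ ^ 2) P →
      Integrable (fun ω => inner ℝ (X ω) (Z ω)) P →
      ∫ ω, ‖X ω - Z ω‖ ^ 2 ∂P =
        ∫ ω, ‖X ω‖ ^ 2 ∂P - 2 * ∫ ω, inner ℝ (X ω) (Z ω) ∂P + ∫ ω, ‖Z ω‖ ^ 2 ∂P := by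
    intro Z h₁ h₂
    have i : Integrable (fun ω => ‖X ω‖ ^ 2 - 2 * inner ℝ (X ω) (Z ω)) P :=
      iX2.sub (h₂.const_mul 2)
    simp only [norm_sub_sq_real]
    rw [integral_add i h₁, integral_sub iX2 (h₂.const_mul 2),
      integral_const_mul]
  have i : Integrable (fun ω => Φ (X ω) + ψ (Y ω)) P := iΦ.add iψ
  have key : ∫ ω, ‖Y ω - gradient Φ (X ω)‖ ^ 2 ∂P ≤
      ∫ ω, 4 * K * (Φ (X ω) + ψ (Y ω) - inner ℝ (X ω) (Y ω)) ∂P :=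
    integral_mono_ae ((hY.sub hT).integrable_norm_pow two_ne_zero)
      ((i.sub iXY).const_mul _) (hYB.mono fun ω hω => hFY _ hω _)
  rw [integral_const_mul, integral_sub i iXY, integral_add iΦ iψ, eψ] at key
  rw [expand _ iY2 iXY, expand _ iT2 iXT, eN]
  linarith

end Potential

/-! ### Coordinates, projections and finite permutations -/

section Coordinates

/-- Extension of a vector in `ℝ^n` to a sequence by zeros. -/
def extendZero {n : ℕ} (v : EuclideanSpace ℝ (Fin n)) : ℕ → ℝ :=
  fun i => if h : i < n then v ⟨i, h⟩ else 0

theorem gradCoord_eq_extendZero {n : ℕ} (Φ : EuclideanSpace ℝ (Fin n) → ℝ) (x : ℕ → ℝ) :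
    (fun i => gradCoord Φ i x) = extendZero (gradient Φ (proj n x)) :=
  rfl

@[simp]
theorem proj_apply {n : ℕ} (x : ℕ → ℝ) (i : Fin n) : proj n x i = x i :=
  rfl

theorem proj_eq_proj_iff {n : ℕ} {x y : ℕ → ℝ} : proj n x = proj n y ↔ ∀ i < n, x i = y i := by
  constructor
  · intro h i hi
    simpa using congrArg (fun v : EuclideanSpace ℝ (Fin n) => v ⟨i, hi⟩) h
  · intro h
    ext i
    simpa using h i i.2

theorem extendZero_proj_of_lt {n i : ℕ} (hi : i < n) (x : ℕ → ℝ) :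
    extendZero (proj n x) i = x i := by
  simp [extendZero, hi]

@[simp]
theorem proj_extendZero {n : ℕ} (v : EuclideanSpace ℝ (Fin n)) : proj n (extendZero v) = v := by
  ext i
  simp [extendZero]

theorem proj_sub_proj {n : ℕ} (x y : ℕ → ℝ) : proj n x - proj n y = proj n (x - y) := by
  ext i
  simp

theorem norm_proj_sq (n : ℕ) (x : ℕ → ℝ) : ‖proj n x‖ ^ 2 = ∑ i ∈ Finset.range n, x i ^ 2 := by
  rw [EuclideanSpace.real_norm_sq_eq, Finset.sum_range]
  rfl

theorem measurable_proj (n : ℕ) : Measurable (proj n) :=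
  (WithLp.measurable_toLp 2 (Fin n → ℝ)).comp (by fun_prop)

theorem measurable_permute (σ : Equiv.Perm ℕ) : Measurable (permute σ) :=
  measurable_pi_lambda _ fun i => measurable_pi_apply (σ i)

theorem measurable_extendZero {n : ℕ} :
    Measurable (extendZero : EuclideanSpace ℝ (Fin n) → ℕ → ℝ) := by
  refine measurable_pi_lambda _ fun i => ?_
  unfold extendZero
  split_ifs <;> fun_prop

theorem measurable_gradCoord {n : ℕ} (Φ : EuclideanSpace ℝ (Fin n) → ℝ) (i : ℕ) :
    Measurable (gradCoord Φ i) :=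
  (measurable_pi_apply i).comp
    (measurable_extendZero.comp ((measurable_gradient Φ).comp (measurable_proj n)))

theorem integral_comp_of_measurePreserving {α β : Type*} [MeasurableSpace α] [MeasurableSpace β]
    {P : Measure α} {Q : Measure β} {g : α → β} (h : MeasurePreserving g P Q) {f : β → ℝ}
    (hf : Measurable f) : ∫ a, f (g a) ∂P = ∫ b, f b ∂Q := by
  rw [← h.map_eq, integral_map h.measurable.aemeasurable hf.aestronglyMeasurable]

theorem IsExchangeable.measurePreserving {μ : Measure (ℕ → ℝ)} (hμ : IsExchangeable μ)
    {σ : Equiv.Perm ℕ} (hσ : IsFinitePerm σ) : MeasurePreserving (permute σ) μ μ :=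
  ⟨measurable_permute σ, hμ σ hσ⟩

theorem IsFinitePerm.inv {σ : Equiv.Perm ℕ} (hσ : IsFinitePerm σ) : IsFinitePerm σ⁻¹ := by
  refine Set.Finite.subset hσ fun i hi h => hi ?_
  rw [Equiv.Perm.inv_eq_iff_eq, h]

theorem IsFinitePerm.mul {σ τ : Equiv.Perm ℕ} (hσ : IsFinitePerm σ) (hτ : IsFinitePerm τ) :
    IsFinitePerm (σ * τ) := by
  refine (Set.Finite.union hσ hτ).subset fun i hi => ?_
  by_contra h
  simp only [Set.mem_union, Set.mem_ofPred_eq, not_or, not_not] at h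
  exact hi (by rw [Equiv.Perm.mul_apply, h.2, h.1])

theorem isFinitePerm_swap (i j : ℕ) : IsFinitePerm (Equiv.swap i j) := by
  refine (Set.toFinite {i, j}).subset fun k hk => ?_
  by_contra h
  simp only [Set.mem_insert_iff, Set.mem_singleton_iff, not_or] at h
  exact hk (Equiv.swap_apply_of_ne_of_ne h.1 h.2)

/-- A finite permutation preserves all sufficiently long initial segments. -/
theorem IsFinitePerm.eventually_lt_iff {σ : Equiv.Perm ℕ} (hσ : IsFinitePerm σ) :
    ∀ᶠ n in atTop, ∀ i, σ i < n ↔ i < n := by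
  obtain ⟨N, hN⟩ := hσ.bddAbove
  filter_upwards [eventually_gt_atTop N] with n hn i
  by_cases h : σ i = i
  · rw [h]
  · have h' : σ (σ i) ≠ σ i := fun e => h (σ.injective e)
    have := hN h
    have := hN h'
    omega

theorem memLp_coord {μ : Measure (ℕ → ℝ)} (hμ : IsExchangeable μ)
    (hμ2 : Integrable (fun x : ℕ → ℝ => x 0 ^ 2) μ) (i : ℕ) :
    MemLp (fun x : ℕ → ℝ => x i) 2 μ := by
  have h := ((memLp_two_iff_integrable_sq
    (measurable_pi_apply 0).aestronglyMeasurable).2 hμ2).comp_measurePreserving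
    (hμ.measurePreserving (isFinitePerm_swap 0 i))
  simpa [Function.comp_def, permute] using h

end Coordinates

/-! ### The stability estimate for projected measures -/

section FiniteDimensional

variable {μ ν : Measure (ℕ → ℝ)} {n : ℕ}
  {Φ : EuclideanSpace ℝ (Fin n) → ℝ} {K : ℝ}

theorem measurePreserving_proj (μ : Measure (ℕ → ℝ)) (n : ℕ) :
    MeasurePreserving (proj n) μ (μ.map (proj n)) :=
  ⟨measurable_proj n, rfl⟩

theorem IsBrenierPotential.measurePreserving
    (hΦ : IsBrenierPotential (μ.map (proj n)) (ν.map (proj n)) Φ) :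
    MeasurePreserving (gradient Φ) (μ.map (proj n)) (ν.map (proj n)) :=
  ⟨measurable_gradient Φ, hΦ.2.2⟩

theorem memLp_proj_comp {Ω : Type*} [MeasurableSpace Ω] {P : Measure Ω} {X : Ω → ℕ → ℝ}
    (hμ2 : ∀ i, MemLp (fun x : ℕ → ℝ => x i) 2 μ)
    (hX : MeasurePreserving (fun ω => proj n (X ω)) P (μ.map (proj n))) :
    MemLp (fun ω => proj n (X ω)) 2 P := by
  have h : MemLp (proj n) 2 μ := MemLp.of_eval_piLp fun i => hμ2 i
  have h' : MemLp id 2 (μ.map (proj n)) :=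
    (memLp_map_measure_iff aestronglyMeasurable_id (measurable_proj n).aemeasurable).2 h
  exact h'.comp_measurePreserving hX

theorem memLp_gradCoord (hν2 : ∀ i, MemLp (fun x : ℕ → ℝ => x i) 2 ν)
    (hΦ : IsBrenierPotential (μ.map (proj n)) (ν.map (proj n)) Φ) (i : ℕ) :
    MemLp (gradCoord Φ i) 2 μ := by
  by_cases hi : i < n
  · have h := memLp_proj_comp (X := fun x j => gradCoord Φ j x) (P := μ) (n := n) hν2 (by
      simp only [gradCoord_eq_extendZero, proj_extendZero]
      exact hΦ.measurePreserving.comp (measurePreserving_proj μ n))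
    exact h.eval_piLp ⟨i, hi⟩
  · have : gradCoord Φ i = 0 := by
      ext x
      simp [gradCoord, hi]
    rw [this]
    exact MemLp.zero

/-- The stability estimate in coordinates. -/
theorem sum_integral_sub_gradCoord_sq_le
    (hμ2 : ∀ i, MemLp (fun x : ℕ → ℝ => x i) 2 μ) (hν2 : ∀ i, MemLp (fun x : ℕ → ℝ => x i) 2 ν)
    (hΦ : IsBrenierPotential (μ.map (proj n)) (ν.map (proj n)) Φ) (hK : 0 < K)
    (hs : ∀ a b, Φ a - Φ b - inner ℝ (gradient Φ b) (a - b) ≤ K * ‖a - b‖ ^ 2)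
    {Ω : Type*} [MeasurableSpace Ω] {P : Measure Ω} [IsProbabilityMeasure P] {X Y : Ω → ℕ → ℝ}
    (hX : MeasurePreserving (fun ω => proj n (X ω)) P (μ.map (proj n)))
    (hY : MeasurePreserving (fun ω => proj n (Y ω)) P (ν.map (proj n))) :
    ∑ i ∈ Finset.range n, ∫ ω, (Y ω i - gradCoord Φ i (X ω)) ^ 2 ∂P ≤
      2 * K * (∑ i ∈ Finset.range n, ∫ ω, (X ω i - Y ω i) ^ 2 ∂P -
        ∑ i ∈ Finset.range n, ∫ x, (x i - gradCoord Φ i x) ^ 2 ∂μ) := by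
  have hG : MeasurePreserving (fun ω => gradient Φ (proj n (X ω))) P (ν.map (proj n)) :=
    hΦ.measurePreserving.comp hX
  have hX2 := memLp_proj_comp hμ2 hX
  have hY2 := memLp_proj_comp hν2 hY
  have hG2 : MemLp (fun ω => gradient Φ (proj n (X ω))) 2 P := by
    have h := memLp_proj_comp (X := fun ω => extendZero (gradient Φ (proj n (X ω)))) (n := n)
      hν2 (by simpa using hG)
    simpa using h
  have h := integral_norm_sub_gradient_sq_le hΦ.1 hΦ.2.1 hK hs hX.measurable hY.measurable
    hX2 hY2 (hY.map_eq.trans hG.map_eq.symm)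
  have expand : ∀ U V : Ω → ℕ → ℝ, MemLp (fun ω => proj n (U ω)) 2 P →
      MemLp (fun ω => proj n (V ω)) 2 P → ∫ ω, ‖proj n (U ω) - proj n (V ω)‖ ^ 2 ∂P =
        ∑ i ∈ Finset.range n, ∫ ω, (U ω i - V ω i) ^ 2 ∂P := by
    intro U V hU hV
    simp only [proj_sub_proj, norm_proj_sq, Pi.sub_apply]
    exact integral_finsetSum _ fun i hi =>
      ((hU.sub hV).eval_piLp ⟨i, Finset.mem_range.1 hi⟩).integrable_sq
  have hgrad : ∀ ω, gradient Φ (proj n (X ω)) = proj n (fun i => gradCoord Φ i (X ω)) :=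
    fun ω => by rw [gradCoord_eq_extendZero, proj_extendZero]
  have hμP : ∀ i ∈ Finset.range n, ∫ x, (x i - gradCoord Φ i x) ^ 2 ∂μ =
      ∫ ω, (X ω i - gradCoord Φ i (X ω)) ^ 2 ∂P := by
    intro i hi
    have hi' := Finset.mem_range.1 hi
    let f : EuclideanSpace ℝ (Fin n) → ℝ := fun v => (v ⟨i, hi'⟩ - gradient Φ v ⟨i, hi'⟩) ^ 2
    have hf : Measurable f := by
      have := measurable_gradient Φ
      fun_prop
    have hf' : ∀ x, (x i - gradCoord Φ i x) ^ 2 = f (proj n x) := fun x => by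
      simp [f, gradCoord, hi']
    simp only [hf']
    rw [integral_comp_of_measurePreserving hX hf,
      integral_comp_of_measurePreserving (measurePreserving_proj μ n) hf]
  simp only [hgrad] at h hG2
  rwa [expand _ _ hY2 hG2, expand _ _ hX2 hY2, expand _ _ hX2 hG2, ← Finset.sum_congr rfl hμP] at h

end FiniteDimensional

/-! ### Equivariance, and dimension-free consequences of stability -/

section Symmetry

variable {μ ν : Measure (ℕ → ℝ)} {n m : ℕ} {Φ : EuclideanSpace ℝ (Fin n) → ℝ}
  {Ψ : EuclideanSpace ℝ (Fin m) → ℝ} {K : ℝ}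

/-- The gradient of a semiconcave Brenier potential between projections of exchangeable measures
commutes almost everywhere with permutations of the coordinates. -/
theorem gradCoord_permute_ae [IsProbabilityMeasure μ]
    (hμ : IsExchangeable μ) (hν : IsExchangeable ν)
    (hμ2 : ∀ i, MemLp (fun x : ℕ → ℝ => x i) 2 μ) (hν2 : ∀ i, MemLp (fun x : ℕ → ℝ => x i) 2 ν)
    (hΦ : IsBrenierPotential (μ.map (proj n)) (ν.map (proj n)) Φ) (hK : 0 < K)
    (hs : ∀ a b, Φ a - Φ b - inner ℝ (gradient Φ b) (a - b) ≤ K * ‖a - b‖ ^ 2)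
    {σ : Equiv.Perm ℕ} (hσ : IsFinitePerm σ) (hσn : ∀ i, σ i < n ↔ i < n) (i : ℕ) :
    (fun x => gradCoord Φ i (permute σ x)) =ᵐ[μ] gradCoord Φ (σ i) := by
  have hσμ := hμ.measurePreserving hσ
  have hinv : ∀ j, σ⁻¹ j < n ↔ j < n := fun j => by
    rw [← hσn (σ⁻¹ j)]
    simp
  let ρ : EuclideanSpace ℝ (Fin n) → EuclideanSpace ℝ (Fin n) :=
    fun v => proj n (permute σ⁻¹ (extendZero v))
  have hρ : MeasurePreserving ρ (ν.map (proj n)) (ν.map (proj n)) := by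
    have hm : Measurable ρ :=
      (measurable_proj n).comp ((measurable_permute _).comp measurable_extendZero)
    refine ⟨hm, ?_⟩
    rw [Measure.map_map hm (measurable_proj n)]
    have : ρ ∘ proj n = proj n ∘ permute σ⁻¹ := by
      ext1 x
      exact proj_eq_proj_iff.2 fun j hj => extendZero_proj_of_lt ((hinv j).2 hj) x
    rw [this, ← Measure.map_map (measurable_proj n) (measurable_permute _), hν _ hσ.inv]
  -- The competitor is the gradient conjugated by `σ`; exchangeability of both measures makes it
  -- transport the same marginals.
  have hY : MeasurePreserving
      (fun x => proj n (permute σ⁻¹ fun j => gradCoord Φ j (permute σ x))) μ (ν.map (proj n)) :=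
    hρ.comp (hΦ.measurePreserving.comp ((measurePreserving_proj μ n).comp hσμ))
  have h := sum_integral_sub_gradCoord_sq_le hμ2 hν2 hΦ hK hs (X := fun x => x)
    (measurePreserving_proj μ n) hY
  -- Relabelling the coordinates by `σ⁻¹` and changing variables by `σ` shows that the competitor
  -- has no cost excess.
  have hcost : ∑ j ∈ Finset.range n,
      ∫ x, (x j - permute σ⁻¹ (fun k => gradCoord Φ k (permute σ x)) j) ^ 2 ∂μ =
      ∑ j ∈ Finset.range n, ∫ x, (x j - gradCoord Φ j x) ^ 2 ∂μ := by
    refine Finset.sum_bij (fun j _ => σ⁻¹ j)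
      (fun j hj => Finset.mem_range.2 ((hinv j).2 (Finset.mem_range.1 hj))) (by simp)
      (fun j hj => ⟨σ j, by simpa [hσn] using hj, by simp⟩) fun j _ => ?_
    have hm := measurable_gradCoord Φ (σ⁻¹ j)
    rw [← integral_comp_of_measurePreserving hσμ
      (f := fun x => (x (σ⁻¹ j) - gradCoord Φ (σ⁻¹ j) x) ^ 2) (by fun_prop)]
    simp [permute]
  rw [hcost, sub_self, mul_zero] at h
  by_cases hi : i < n
  · have hm := measurable_gradCoord Φ i
    have hz : ∫ x, (gradCoord Φ i (permute σ x) - gradCoord Φ (σ i) x) ^ 2 ∂μ = 0 := by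
      have h₀ := (Finset.sum_eq_zero_iff_of_nonneg fun j _ =>
        integral_nonneg fun x => sq_nonneg _).1
          (le_antisymm h (Finset.sum_nonneg fun j _ => integral_nonneg fun x => sq_nonneg _))
          (σ i) (Finset.mem_range.2 ((hσn i).2 hi))
      simpa [permute] using h₀
    have hint : Integrable
        (fun x => (gradCoord Φ i (permute σ x) - gradCoord Φ (σ i) x) ^ 2) μ :=
      (((memLp_gradCoord hν2 hΦ i).comp_measurePreserving hσμ).sub
        (memLp_gradCoord hν2 hΦ (σ i))).integrable_sq
    filter_upwards [(integral_eq_zero_iff_of_nonneg (fun x => sq_nonneg _) hint).1 hz] with x hx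
    exact sub_eq_zero.1 (pow_eq_zero_iff two_ne_zero |>.1 hx)
  -- Here `i` and `σ i` are both outside the first `n` indices, where `gradCoord` has the default
  -- value `0`.
  · refine ae_of_all _ fun x => ?_
    simp [gradCoord, hi, hσn]

theorem gradCoord_swap_ae [IsProbabilityMeasure μ]
    (hμ : IsExchangeable μ) (hν : IsExchangeable ν)
    (hμ2 : ∀ i, MemLp (fun x : ℕ → ℝ => x i) 2 μ) (hν2 : ∀ i, MemLp (fun x : ℕ → ℝ => x i) 2 ν)
    (hΦ : IsBrenierPotential (μ.map (proj n)) (ν.map (proj n)) Φ) (hK : 0 < K)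
    (hs : ∀ a b, Φ a - Φ b - inner ℝ (gradient Φ b) (a - b) ≤ K * ‖a - b‖ ^ 2)
    {i : ℕ} (hi : i < n) :
    (fun x => gradCoord Φ 0 (permute (Equiv.swap 0 i) x)) =ᵐ[μ] gradCoord Φ i := by
  have h := gradCoord_permute_ae hμ hν hμ2 hν2 hΦ hK hs (isFinitePerm_swap 0 i) (fun j => by
    rw [Equiv.swap_apply_def]
    split_ifs <;> omega) 0
  rwa [Equiv.swap_apply_left] at h

theorem integral_sub_gradCoord_sq [IsProbabilityMeasure μ]
    (hμ : IsExchangeable μ) (hν : IsExchangeable ν)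
    (hμ2 : ∀ i, MemLp (fun x : ℕ → ℝ => x i) 2 μ) (hν2 : ∀ i, MemLp (fun x : ℕ → ℝ => x i) 2 ν)
    (hΦ : IsBrenierPotential (μ.map (proj n)) (ν.map (proj n)) Φ) (hK : 0 < K)
    (hs : ∀ a b, Φ a - Φ b - inner ℝ (gradient Φ b) (a - b) ≤ K * ‖a - b‖ ^ 2)
    {i : ℕ} (hi : i < n) :
    ∫ x, (x i - gradCoord Φ i x) ^ 2 ∂μ = ∫ x, (x 0 - gradCoord Φ 0 x) ^ 2 ∂μ := by
  have hm := measurable_gradCoord Φ 0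
  rw [← integral_comp_of_measurePreserving (hμ.measurePreserving (isFinitePerm_swap 0 i))
    (f := fun x => (x 0 - gradCoord Φ 0 x) ^ 2) (by fun_prop)]
  refine integral_congr_ae ?_
  filter_upwards [gradCoord_swap_ae hμ hν hμ2 hν2 hΦ hK hs hi] with x hx
  rw [hx]
  simp [permute]

theorem integral_gradCoord_sub_gradCoord_sq [IsProbabilityMeasure μ]
    (hμ : IsExchangeable μ) (hν : IsExchangeable ν)
    (hμ2 : ∀ i, MemLp (fun x : ℕ → ℝ => x i) 2 μ) (hν2 : ∀ i, MemLp (fun x : ℕ → ℝ => x i) 2 ν)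
    (hΦ : IsBrenierPotential (μ.map (proj n)) (ν.map (proj n)) Φ)
    (hΨ : IsBrenierPotential (μ.map (proj m)) (ν.map (proj m)) Ψ) (hK : 0 < K)
    (hs : ∀ a b, Φ a - Φ b - inner ℝ (gradient Φ b) (a - b) ≤ K * ‖a - b‖ ^ 2)
    (hs' : ∀ a b, Ψ a - Ψ b - inner ℝ (gradient Ψ b) (a - b) ≤ K * ‖a - b‖ ^ 2)
    {i : ℕ} (hn : i < n) (hm : i < m) :
    ∫ x, (gradCoord Ψ i x - gradCoord Φ i x) ^ 2 ∂μ =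
      ∫ x, (gradCoord Ψ 0 x - gradCoord Φ 0 x) ^ 2 ∂μ := by
  have h₁ := measurable_gradCoord Φ 0
  have h₂ := measurable_gradCoord Ψ 0
  rw [← integral_comp_of_measurePreserving (hμ.measurePreserving (isFinitePerm_swap 0 i))
    (f := fun x => (gradCoord Ψ 0 x - gradCoord Φ 0 x) ^ 2) (by fun_prop)]
  refine integral_congr_ae ?_
  filter_upwards [gradCoord_swap_ae hμ hν hμ2 hν2 hΦ hK hs hn,
    gradCoord_swap_ae hμ hν hμ2 hν2 hΨ hK hs' hm] with x hx hx'
  rw [hx, hx']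

/-- Truncating a higher-dimensional Brenier map gives a competitor in lower dimension, since the
projections of `ν` are consistent. The truncation still depends on all `m` variables, so it is a
coupling and not a map of `ℝ^n`. -/
theorem measurePreserving_proj_gradCoord (hnm : n ≤ m)
    (hΨ : IsBrenierPotential (μ.map (proj m)) (ν.map (proj m)) Ψ) :
    MeasurePreserving (fun x => proj n fun i => gradCoord Ψ i x) μ (ν.map (proj n)) := by
  have hr : Measurable fun v : EuclideanSpace ℝ (Fin m) => proj n (extendZero v) :=
    (measurable_proj n).comp measurable_extendZero
  have h : MeasurePreserving (fun v : EuclideanSpace ℝ (Fin m) => proj n (extendZero v))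
      (ν.map (proj m)) (ν.map (proj n)) := by
    refine ⟨hr, ?_⟩
    rw [Measure.map_map hr (measurable_proj m)]
    congr 1
    ext1 x
    exact proj_eq_proj_iff.2 fun i hi => extendZero_proj_of_lt (hi.trans_le hnm) x
  exact h.comp (hΨ.measurePreserving.comp (measurePreserving_proj μ m))

/-- The first components of the gradients form an `L²` Cauchy sequence as soon as the
normalized transport costs converge. -/
theorem integral_gradCoord_zero_sub_sq_le [IsProbabilityMeasure μ]
    (hμ : IsExchangeable μ) (hν : IsExchangeable ν)
    (hμ2 : ∀ i, MemLp (fun x : ℕ → ℝ => x i) 2 μ) (hν2 : ∀ i, MemLp (fun x : ℕ → ℝ => x i) 2 ν)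
    (hΦ : IsBrenierPotential (μ.map (proj n)) (ν.map (proj n)) Φ)
    (hΨ : IsBrenierPotential (μ.map (proj m)) (ν.map (proj m)) Ψ) (hK : 0 < K)
    (hs : ∀ a b, Φ a - Φ b - inner ℝ (gradient Φ b) (a - b) ≤ K * ‖a - b‖ ^ 2)
    (hs' : ∀ a b, Ψ a - Ψ b - inner ℝ (gradient Ψ b) (a - b) ≤ K * ‖a - b‖ ^ 2)
    (hn : 0 < n) (hnm : n ≤ m) :
    ∫ x, (gradCoord Ψ 0 x - gradCoord Φ 0 x) ^ 2 ∂μ ≤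
      2 * K * (∫ x, (x 0 - gradCoord Ψ 0 x) ^ 2 ∂μ - ∫ x, (x 0 - gradCoord Φ 0 x) ^ 2 ∂μ) := by
  have h := sum_integral_sub_gradCoord_sq_le hμ2 hν2 hΦ hK hs (X := fun x => x)
    (measurePreserving_proj μ n) (measurePreserving_proj_gradCoord hnm hΨ)
  rw [Finset.sum_congr rfl fun i hi => integral_gradCoord_sub_gradCoord_sq hμ hν hμ2 hν2 hΦ hΨ hK
      hs hs' (Finset.mem_range.1 hi) ((Finset.mem_range.1 hi).trans_le hnm),
    Finset.sum_congr rfl fun i hi => integral_sub_gradCoord_sq hμ hν hμ2 hν2 hΨ hK hs'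
      ((Finset.mem_range.1 hi).trans_le hnm),
    Finset.sum_congr rfl fun i hi => integral_sub_gradCoord_sq hμ hν hμ2 hν2 hΦ hK hs
      (Finset.mem_range.1 hi)] at h
  simp only [Finset.sum_const, Finset.card_range, nsmul_eq_mul] at h
  have hn' : (0 : ℝ) < n := by exact_mod_cast hn
  refine le_of_mul_le_mul_left ?_ hn'
  linarith

/-- The normalized finite-dimensional transport cost is a lower bound for the cost of every
exchangeable plan. -/
theorem ofReal_integral_sub_gradCoord_sq_le_cost [IsProbabilityMeasure μ]
    (hμ : IsExchangeable μ) (hν : IsExchangeable ν)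
    (hμ2 : ∀ i, MemLp (fun x : ℕ → ℝ => x i) 2 μ) (hν2 : ∀ i, MemLp (fun x : ℕ → ℝ => x i) 2 ν)
    (hΦ : IsBrenierPotential (μ.map (proj n)) (ν.map (proj n)) Φ) (hK : 0 < K)
    (hs : ∀ a b, Φ a - Φ b - inner ℝ (gradient Φ b) (a - b) ≤ K * ‖a - b‖ ^ 2)
    (hn : 0 < n) {π : Measure ((ℕ → ℝ) × (ℕ → ℝ))} (hπ : π ∈ exchangeablePlans μ ν) :
    ENNReal.ofReal (∫ x, (x 0 - gradCoord Φ 0 x) ^ 2 ∂μ) ≤ cost π := by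
  obtain ⟨hex, hfst, hsnd⟩ := hπ
  have h₁ : MeasurePreserving Prod.fst π μ := ⟨measurable_fst, hfst⟩
  have h₂ : MeasurePreserving Prod.snd π ν := ⟨measurable_snd, hsnd⟩
  have hprob : IsProbabilityMeasure π := ⟨by
    have := h₁.measure_preimage (s := Set.univ) MeasurableSet.univ.nullMeasurableSet
    simpa using this⟩
  have h := sum_integral_sub_gradCoord_sq_le hμ2 hν2 hΦ hK hs
    (X := fun p : (ℕ → ℝ) × (ℕ → ℝ) => p.1) (Y := fun p => p.2)
    ((measurePreserving_proj μ n).comp h₁) ((measurePreserving_proj ν n).comp h₂)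
  have hcoord : ∀ i, ∫ p, (p.1 i - p.2 i) ^ 2 ∂π = ∫ p, (p.1 0 - p.2 0) ^ 2 ∂π := by
    intro i
    have hp : MeasurePreserving
        (Prod.map (permute (Equiv.swap 0 i)) (permute (Equiv.swap 0 i))) π π :=
      ⟨(measurable_permute _).prodMap (measurable_permute _), hex _ (isFinitePerm_swap 0 i)⟩
    rw [← integral_comp_of_measurePreserving hp (f := fun p => (p.1 0 - p.2 0) ^ 2)
      (by fun_prop)]
    simp [permute]
  rw [Finset.sum_congr rfl fun i hi => integral_sub_gradCoord_sq hμ hν hμ2 hν2 hΦ hK hs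
      (Finset.mem_range.1 hi), Finset.sum_congr rfl fun i hi => hcoord i] at h
  simp only [Finset.sum_const, Finset.card_range, nsmul_eq_mul] at h
  -- Only the sign of the left side of the stability estimate is needed: the excess is nonnegative.
  have h₀ := (Finset.sum_nonneg fun i _ => integral_nonneg fun p => sq_nonneg _).trans h
  have hn' : (0 : ℝ) < n := by exact_mod_cast hn
  have hle : ∫ x, (x 0 - gradCoord Φ 0 x) ^ 2 ∂μ ≤ ∫ p, (p.1 0 - p.2 0) ^ 2 ∂π := by
    rw [← mul_sub, mul_nonneg_iff_of_pos_left (by positivity),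
      mul_nonneg_iff_of_pos_left hn'] at h₀
    linarith
  have hint : Integrable (fun p : (ℕ → ℝ) × (ℕ → ℝ) => (p.1 0 - p.2 0) ^ 2) π :=
    (((hμ2 0).comp_measurePreserving h₁).sub ((hν2 0).comp_measurePreserving h₂)).integrable_sq
  rw [cost, ← ofReal_integral_eq_lintegral_ofReal hint (ae_of_all _ fun p => sq_nonneg _)]
  exact ENNReal.ofReal_le_ofReal hle

end Symmetry

/-! ### Passage to the limit in dimension -/

section Limit

theorem eLpNorm_two_eq_ofReal_sqrt {α : Type*} [MeasurableSpace α] {μ : Measure α} {f : α → ℝ}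
    (hf : MemLp f 2 μ) : eLpNorm f 2 μ = ENNReal.ofReal √(∫ x, f x ^ 2 ∂μ) := by
  rw [hf.eLpNorm_eq_integral_rpow_norm two_ne_zero ENNReal.ofNat_ne_top, Real.sqrt_eq_rpow]
  simp

theorem exists_subseq_tendsto_ae_finset {α ι : Type*} [MeasurableSpace α] {μ : Measure α}
    {f : ℕ → ι → α → ℝ} {g : ι → α → ℝ}
    (h : ∀ i, TendstoInMeasure μ (fun n => f n i) atTop (g i)) (I : Finset ι) :
    ∃ φ : ℕ → ℕ, StrictMono φ ∧
      ∀ᵐ x ∂μ, ∀ i ∈ I, Tendsto (fun k => f (φ k) i x) atTop (nhds (g i x)) := by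
  classical
  induction I using Finset.induction_on with
  | empty => exact ⟨id, strictMono_id, by simp⟩
  | insert i I _ ih =>
    obtain ⟨φ, hφ, hI⟩ := ih
    obtain ⟨ψ, hψ, hi⟩ := ((h i).comp hφ.tendsto_atTop).exists_seq_tendsto_ae
    refine ⟨φ ∘ ψ, hφ.comp hψ, ?_⟩
    filter_upwards [hI, hi] with x hx hx' j hj
    rcases Finset.mem_insert.1 hj with rfl | hj
    · exact hx'
    · exact (hx j hj).comp hψ.tendsto_atTop

/-- The displacement `i ↦ σ i - i` is a finitely supported integer sequence that determines `σ`.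
Countability lets the null sets for all `σ` be merged into one. -/
theorem countable_isFinitePerm : Countable {σ : Equiv.Perm ℕ // IsFinitePerm σ} := by
  let F : {σ : Equiv.Perm ℕ // IsFinitePerm σ} → (ℕ →₀ ℤ) := fun σ =>
    Finsupp.ofSupportFinite (fun i => (σ.1 i : ℤ) - i) (σ.2.subset fun i hi h => hi (by simp [h]))
  refine Function.Injective.countable (f := F) fun σ τ h => Subtype.ext (Equiv.ext fun i => ?_)
  have h' : (σ.1 i : ℤ) - i = τ.1 i - i := DFunLike.congr_fun h i
  omega

/-- A map that commutes almost everywhere with finite permutations has an almost everywhere equal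
modification that commutes with them everywhere. -/
theorem exists_exchangeable_modification {μ : Measure (ℕ → ℝ)} {T : (ℕ → ℝ) → ℕ → ℝ}
    (hT : Measurable T)
    (h : ∀ σ, IsFinitePerm σ → ∀ᵐ x ∂μ, T (permute σ x) = permute σ (T x)) :
    ∃ S : (ℕ → ℝ) → ℕ → ℝ, Measurable S ∧ IsExchangeableMap S ∧ S =ᵐ[μ] T := by
  classical
  have := countable_isFinitePerm
  let A : Set (ℕ → ℝ) := {x | ∀ σ : {σ // IsFinitePerm σ}, T (permute σ x) = permute σ (T x)}
  have hA : MeasurableSet A := by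
    have : A = ⋂ σ : {σ // IsFinitePerm σ}, {x | T (permute σ x) = permute σ (T x)} := by
      ext x
      simp [A]
    rw [this]
    exact MeasurableSet.iInter fun σ => measurableSet_eq_fun
      (hT.comp (measurable_permute _)) ((measurable_permute _).comp hT)
  -- `permute` reverses products. The group law makes the set `A` of good points invariant.
  have comp : ∀ (σ τ : Equiv.Perm ℕ) (x : ℕ → ℝ),
      permute σ (permute τ x) = permute (τ * σ) x := fun σ τ x => rfl
  have hinv : ∀ σ : Equiv.Perm ℕ, IsFinitePerm σ → ∀ x ∈ A, permute σ x ∈ A := by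
    intro σ hσ x hx τ
    rw [comp, hx ⟨_, hσ.mul τ.2⟩, hx ⟨σ, hσ⟩, comp]
  have hiff : ∀ σ : Equiv.Perm ℕ, IsFinitePerm σ → ∀ x, permute σ x ∈ A ↔ x ∈ A := by
    intro σ hσ x
    refine ⟨fun hx => ?_, hinv σ hσ x⟩
    have := hinv σ⁻¹ hσ.inv _ hx
    rwa [comp, mul_inv_cancel] at this
  -- The zero sequence is fixed by all permutations, so this value off the invariant set `A` keeps
  -- equivariance.
  refine ⟨fun x => if x ∈ A then T x else 0, hT.ite hA measurable_const, ?_, ?_⟩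
  · intro σ hσ
    ext1 x
    simp only [Function.comp_apply, hiff σ hσ]
    split_ifs with hx
    · exact hx ⟨σ, hσ⟩
    · rfl
  · have hae : ∀ᵐ x ∂μ, x ∈ A := ae_all_iff.2 fun σ => h σ σ.2
    filter_upwards [hae] with x hx
    simp [hx]

variable {μ ν : Measure (ℕ → ℝ)} {Φ : ∀ n : ℕ, EuclideanSpace ℝ (Fin n) → ℝ}

theorem integral_gradCoord_zero_sq {n : ℕ} (hn : 0 < n)
    (hΦ : IsBrenierPotential (μ.map (proj n)) (ν.map (proj n)) (Φ n)) :
    ∫ x, gradCoord (Φ n) 0 x ^ 2 ∂μ = ∫ y, y 0 ^ 2 ∂ν := by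
  have hf : Measurable fun v : EuclideanSpace ℝ (Fin 1) => v 0 ^ 2 := by fun_prop
  exact (integral_comp_of_measurePreserving (measurePreserving_proj_gradCoord hn hΦ) hf).trans
    (integral_comp_of_measurePreserving (measurePreserving_proj ν 1) hf).symm

variable [IsProbabilityMeasure μ]

/-- The components of the gradients of uniformly semiconcave Brenier potentials between the
projections of exchangeable measures converge in `L²`. -/
theorem exists_tendsto_eLpNorm_gradCoord (hμ : IsExchangeable μ) (hν : IsExchangeable ν)
    (hμ2 : ∀ i, MemLp (fun x : ℕ → ℝ => x i) 2 μ) (hν2 : ∀ i, MemLp (fun x : ℕ → ℝ => x i) 2 ν)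
    (hA : AssumptionA μ ν Φ) (i : ℕ) :
    ∃ T : (ℕ → ℝ) → ℝ, Measurable T ∧
      Tendsto (fun n => eLpNorm (gradCoord (Φ n) i - T) 2 μ) atTop (nhds 0) := by
  obtain ⟨hΦ, K, hK, hs⟩ := hA
  let c : ℕ → ℝ := fun n => ∫ x, (x 0 - gradCoord (Φ n) 0 x) ^ 2 ∂μ
  have hle : ∀ n m, 0 < n → n ≤ m → ∫ x, (gradCoord (Φ m) 0 x - gradCoord (Φ n) 0 x) ^ 2 ∂μ ≤
      2 * K * (c m - c n) := fun n m hn hnm =>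
    integral_gradCoord_zero_sub_sq_le hμ hν hμ2 hν2 (hΦ n) (hΦ m) hK (hs n) (hs m) hn hnm
  -- The shift by `i + 1` makes every dimension positive and larger than `i`, so that the `i`-th
  -- partial derivative is never the default value.
  have hmono : Monotone fun k => c (k + i + 1) := fun a b hab => by
    have h := (integral_nonneg fun x => sq_nonneg _).trans
      (hle (a + i + 1) (b + i + 1) (by omega) (by omega))
    rw [mul_nonneg_iff_of_pos_left (by positivity)] at h
    exact sub_nonneg.1 h
  have hbdd : BddAbove (Set.range fun k => c (k + i + 1)) := by
    refine ⟨2 * ∫ x, x 0 ^ 2 ∂μ + 2 * ∫ y, y 0 ^ 2 ∂ν, ?_⟩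
    rintro _ ⟨k, rfl⟩
    have hG := memLp_gradCoord hν2 (hΦ (k + i + 1)) 0
    rw [← integral_gradCoord_zero_sq (Nat.succ_pos _) (hΦ (k + i + 1)), ← integral_const_mul,
      ← integral_const_mul, ← integral_add ((hμ2 0).integrable_sq.const_mul 2)
        (hG.integrable_sq.const_mul 2)]
    refine integral_mono ((hμ2 0).sub hG).integrable_sq
      (((hμ2 0).integrable_sq.const_mul 2).add (hG.integrable_sq.const_mul 2)) fun x => ?_
    simp only
    nlinarith [sq_nonneg (x 0 + gradCoord (Φ (k + i + 1)) 0 x)]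
  have hlim := tendsto_atTop_ciSup hmono hbdd
  set L := ⨆ k, c (k + i + 1)
  have hG : ∀ k, MemLp (gradCoord (Φ (k + i + 1)) i) 2 μ := fun k =>
    memLp_gradCoord hν2 (hΦ _) i
  let f : ℕ → Lp ℝ 2 μ := fun k => (hG k).toLp
  have hf : CauchySeq f := by
    refine cauchySeq_of_le_tendsto_0' (fun a => √(2 * K * (L - c (a + i + 1)))) ?_ ?_
    · intro a b hab
      rw [dist_comm, Lp.dist_edist, Lp.edist_toLp_toLp,
        eLpNorm_two_eq_ofReal_sqrt ((hG b).sub (hG a)),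
        ENNReal.toReal_ofReal (Real.sqrt_nonneg _)]
      refine Real.sqrt_le_sqrt ?_
      simp only [Pi.sub_apply]
      rw [integral_gradCoord_sub_gradCoord_sq hμ hν hμ2 hν2 (hΦ (a + i + 1)) (hΦ (b + i + 1)) hK
        (hs _) (hs _) (by omega) (by omega)]
      refine (hle _ _ (by omega) (by omega)).trans ?_
      have := le_ciSup hbdd b
      gcongr
    · have h := ((hlim.const_sub L).const_mul (2 * K)).sqrt
      simpa using h
  obtain ⟨T, hT⟩ := cauchySeq_tendsto_of_complete hf
  refine ⟨T, (Lp.stronglyMeasurable T).measurable, ?_⟩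
  rw [← tendsto_add_atTop_iff_nat (i + 1)]
  refine ((Lp.tendsto_Lp_iff_tendsto_eLpNorm' f T).1 hT).congr fun k => ?_
  exact eLpNorm_congr_ae ((hG k).coeFn_toLp.sub (ae_eq_refl _))

/-- A measure on sequences is determined by its finite-dimensional marginals, and these by bounded
continuous test functions. Once the dimension covers a finite index set, the gradient already has
the marginal of `ν` there, so the integrals being passed to the limit are eventually constant. -/
theorem map_eq_of_tendstoInMeasure_gradCoord [IsProbabilityMeasure ν] {T : (ℕ → ℝ) → ℕ → ℝ}
    (hT : Measurable T) (hΦ : ∀ n, IsBrenierPotential (μ.map (proj n)) (ν.map (proj n)) (Φ n))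
    (h : ∀ i, TendstoInMeasure μ (fun n => gradCoord (Φ n) i) atTop fun x => T x i) :
    μ.map T = ν := by
  have : IsProbabilityMeasure (μ.map T) := Measure.isProbabilityMeasure_map hT.aemeasurable
  have hfin : ∀ I : Finset ℕ, IsFiniteMeasure (ν.map (I.restrict (π := fun _ => ℝ))) :=
    fun I => inferInstance
  refine IsProjectiveLimit.unique (P := fun I => ν.map I.restrict) (fun I => ?_) fun I => rfl
  have hr : Measurable (I.restrict (π := fun _ : ℕ => ℝ)) := Finset.measurable_restrict I
  refine ext_of_forall_integral_eq_of_IsFiniteMeasure fun g => ?_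
  have hg : Measurable g := g.continuous.measurable
  rw [Measure.map_map hr hT, integral_map (hr.comp hT).aemeasurable hg.aestronglyMeasurable,
    integral_map hr.aemeasurable hg.aestronglyMeasurable]
  obtain ⟨φ, hφ, hae⟩ := exists_subseq_tendsto_ae_finset h I
  obtain ⟨N, hN⟩ := I.exists_nat_subset_range
  have hGm : ∀ n, Measurable fun x i => gradCoord (Φ n) i x := fun n =>
    measurable_pi_lambda _ fun i => measurable_gradCoord (Φ n) i
  have hlim : Tendsto (fun k => ∫ x, g (I.restrict fun i => gradCoord (Φ (φ k)) i x) ∂μ) atTop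
      (nhds (∫ x, g (I.restrict (T x)) ∂μ)) := by
    refine tendsto_integral_of_dominated_convergence (fun _ => ‖g‖)
      (fun k => (hg.comp (hr.comp (hGm _))).aestronglyMeasurable) (integrable_const _)
      (fun k => ae_of_all _ fun x => g.norm_coe_le_norm _) ?_
    filter_upwards [hae] with x hx
    exact (g.continuous.tendsto _).comp (tendsto_pi_nhds.2 fun i => hx i i.2)
  refine tendsto_nhds_unique hlim (tendsto_const_nhds.congr' ?_)
  filter_upwards [hφ.tendsto_atTop.eventually_ge_atTop N] with k hk
  let F : EuclideanSpace ℝ (Fin N) → ℝ := fun v => g (I.restrict (extendZero v))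
  have hF : Measurable F := hg.comp (hr.comp measurable_extendZero)
  have hFy : ∀ y : ℕ → ℝ, g (I.restrict y) = F (proj N y) := fun y => by
    refine congrArg g (funext fun i => ?_)
    exact (extendZero_proj_of_lt (Finset.mem_range.1 (hN i.2)) y).symm
  simp only [hFy]
  rw [integral_comp_of_measurePreserving (measurePreserving_proj ν N) hF,
    integral_comp_of_measurePreserving (measurePreserving_proj_gradCoord hk (hΦ (φ k))) hF]

end Limit

end ExchangeableOT

/-! ### Existence of the exchangeable optimal map -/

theorem theorem3 (μ ν : Measure (ℕ → ℝ)) [IsProbabilityMeasure μ] [IsProbabilityMeasure ν]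
    (hμ : ExchangeableOT.IsExchangeable μ) (hν : ExchangeableOT.IsExchangeable ν)
    (hμ2 : Integrable (fun x : ℕ → ℝ => x 0 ^ 2) μ)
    (hν2 : Integrable (fun y : ℕ → ℝ => y 0 ^ 2) ν)
    (Φ : ∀ n : ℕ, EuclideanSpace ℝ (Fin n) → ℝ)
    (hA : ExchangeableOT.AssumptionA μ ν Φ) :
    ∃ T : (ℕ → ℝ) → (ℕ → ℝ), ExchangeableOT.SolvesMonge μ ν T ∧
      ∃ φ : ℕ → ℕ, StrictMono φ ∧ ∀ i : ℕ,
        TendstoInMeasure μ (fun k => ExchangeableOT.gradCoord (Φ (φ k)) i) atTop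
          (fun x => T x i) := by
  open ExchangeableOT in
  have mμ := memLp_coord hμ hμ2
  have mν := memLp_coord hν hν2
  choose T hTm hT using exists_tendsto_eLpNorm_gradCoord hμ hν mμ mν hA
  obtain ⟨hΦ, K, hK, hs⟩ := hA
  have hGm : ∀ n i, AEStronglyMeasurable (gradCoord (Φ n) i) μ := fun n i =>
    (measurable_gradCoord _ i).aestronglyMeasurable
  have hTmeas : ∀ i, TendstoInMeasure μ (fun n => gradCoord (Φ n) i) atTop (T i) := fun i =>
    tendstoInMeasure_of_tendsto_eLpNorm two_ne_zero (fun n => hGm n i)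
      (hTm i).aestronglyMeasurable (hT i)
  have hequiv : ∀ σ, IsFinitePerm σ → ∀ i, (fun x => T i (permute σ x)) =ᵐ[μ] T (σ i) := by
    intro σ hσ i
    have hp := hμ.measurePreserving hσ
    have h : TendstoInMeasure μ (fun n x => gradCoord (Φ n) i (permute σ x)) atTop
        fun x => T i (permute σ x) := by
      refine tendstoInMeasure_of_tendsto_eLpNorm two_ne_zero
        (fun n => (hGm n i).comp_measurePreserving hp)
        ((hTm i).aestronglyMeasurable.comp_measurePreserving hp) ((hT i).congr fun n => ?_)
      exact (eLpNorm_comp_measurePreserving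
        ((hGm n i).sub (hTm i).aestronglyMeasurable) hp).symm
    -- Both sides are limits in measure of sequences that agree almost everywhere once `σ` preserves
    -- the first `n` indices.
    refine tendstoInMeasure_ae_unique (h.congr' ?_ (ae_eq_refl _)) (hTmeas (σ i))
    filter_upwards [hσ.eventually_lt_iff] with n hn
    exact gradCoord_permute_ae hμ hν mμ mν (hΦ n) hK (hs n) hσ hn i
  obtain ⟨S, hSm, hSex, hST⟩ := exists_exchangeable_modification (μ := μ) (T := fun x i => T i x)
    (measurable_pi_lambda _ hTm) fun σ hσ => by
      filter_upwards [ae_all_iff.2 (hequiv σ hσ)] with x hx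
      exact funext hx
  have hSi : ∀ i, T i =ᵐ[μ] fun x => S x i := fun i => by
    filter_upwards [hST] with x hx
    rw [hx]
  have hconv : ∀ i, TendstoInMeasure μ (fun n => gradCoord (Φ n) i) atTop fun x => S x i :=
    fun i => (hTmeas i).congr_right (hSi i)
  have hgraph : Measurable fun x => (x, S x) := measurable_id.prodMk hSm
  -- The whole sequence converges, so the identity serves as the subsequence.
  refine ⟨S, ⟨hSm, hSex, ⟨?_, ?_, ?_⟩, fun π hπ => ?_⟩, id, strictMono_id, hconv⟩
  · intro σ hσ
    have hp := (measurable_permute σ).prodMap (measurable_permute σ)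
    have hcomp : Prod.map (permute σ) (permute σ) ∘ (fun x => (x, S x)) =
        (fun x => (x, S x)) ∘ permute σ := by
      ext1 x
      exact Prod.ext rfl (congrFun (hSex σ hσ) x).symm
    rw [Measure.map_map hp hgraph, hcomp, ← Measure.map_map hgraph (measurable_permute σ),
      hμ σ hσ]
  · rw [Measure.map_map measurable_fst hgraph]
    exact Measure.map_id
  · rw [Measure.map_map measurable_snd hgraph]
    exact map_eq_of_tendstoInMeasure_gradCoord hSm hΦ hconv
  · have hcost : cost (μ.map fun x => (x, S x)) =
        ∫⁻ x, ENNReal.ofReal ((x 0 - S x 0) ^ 2) ∂μ := by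
      rw [cost, lintegral_map (by fun_prop) hgraph]
    -- Fatou's lemma along an almost everywhere convergent subsequence; each cost `c_n` with `n > 0`
    -- is already at most `cost π`.
    obtain ⟨φ, hφ, hae⟩ := (hconv 0).exists_seq_tendsto_ae
    rw [hcost]
    calc ∫⁻ x, ENNReal.ofReal ((x 0 - S x 0) ^ 2) ∂μ
        = ∫⁻ x, liminf (fun k => ENNReal.ofReal ((x 0 - gradCoord (Φ (φ k)) 0 x) ^ 2)) atTop ∂μ :=
          lintegral_congr_ae (hae.mono fun x hx =>
            (ENNReal.tendsto_ofReal ((hx.const_sub (x 0)).pow 2)).liminf_eq.symm)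
      _ ≤ liminf (fun k => ∫⁻ x, ENNReal.ofReal ((x 0 - gradCoord (Φ (φ k)) 0 x) ^ 2) ∂μ) atTop :=
          lintegral_liminf_le fun k => by
            have := measurable_gradCoord (Φ (φ k)) 0
            fun_prop
      _ ≤ liminf (fun _ : ℕ => cost π) atTop := by
          refine liminf_le_liminf ?_
          filter_upwards [hφ.tendsto_atTop.eventually_gt_atTop 0] with k hk
          have hint : Integrable (fun x : ℕ → ℝ => (x 0 - gradCoord (Φ (φ k)) 0 x) ^ 2) μ :=
            ((mμ 0).sub (memLp_gradCoord mν (hΦ (φ k)) 0)).integrable_sq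
          rw [← ofReal_integral_eq_lintegral_ofReal hint (ae_of_all _ fun x => sq_nonneg _)]
          exact ofReal_integral_sub_gradCoord_sq_le_cost hμ hν mμ mν (hΦ _) hK (hs _) hk hπ
      _ = cost π := liminf_const _
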